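/- Let $G$ be a finite group. A stem extension of $G$ is a group $E$ with a surjective homomorphism $\pi\colon E\to G$ such that $\ker\pi\subseteq Z(E)\cap[E,E]$; a Schur cover of $G$ is a stem extension of $G$ of maximal order. Every finite group has a Schur cover. The deep commuting graph $\Delta_D(G)$, computed from a Schur cover $\pi\colon\tilde G\to G$, is the simple graph with vertex set $G$ in which two distinct elements are adjacent if and only if their preimages under $\pi$ commute in $\tilde G$. Theorem. Let $\Gamma$ be a finite simple undirected graph. Then: (i) there is a finite nilpotent group $G$ such that $\Delta_D(G)$ contains an induced subgraph isomorphic to $\Gamma$; (ii) there is a finite abelian group $G_1$ such that $\Delta_D(G_1)$ contains an induced subgraph isomorphic to $\Gamma$; (iii) there is a finite non-abelian nilpotent group $G_2$ such that $\Delta_D(G_2)$ contains an induced subgraph isomorphic to $\Gamma$. In each case the assertion holds for $\Delta_D$ computed from any Schur cover of the group. -/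

import Mathlib

universe u

/-- `π : E →* G` is a stem extension of `G` (with kernel `ker π`): `π` is surjective and its kernel
lies in `Z(E) ∩ [E, E]`. -/
structure IsStemExtension {E G : Type u} [Group E] [Group G] (π : E →* G) : Prop where
  surjective : Function.Surjective π
  ker_le_center : π.ker ≤ Subgroup.center E
  ker_le_commutator : π.ker ≤ commutator E

/-- `π : E →* G` is a Schur cover of the finite group `G`: a (finite) stem extension of maximal
order among all stem extensions of `G`. -/
structure IsSchurCover {E G : Type u} [Group E] [Group G] (π : E →* G) : Prop where
  isStem : IsStemExtension π
  finite : Finite E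
  card_le : ∀ (E' : Type u) [Group E'] (π' : E' →* G),
    IsStemExtension π' → Nat.card E' ≤ Nat.card E

/-- A Schur cover of `G`, as a group `E` together with its projection `π` onto `G`. -/
structure SchurCover (G : Type u) [Group G] where
  E : Type u
  [group : Group E]
  π : E →* G
  isSchurCover : IsSchurCover π

attribute [instance] SchurCover.group

/-- The deep commuting graph of `G`, computed from the Schur cover `C` of `G`: the vertices are the
elements of `G`, and two distinct elements are adjacent iff their preimages in `C.E` commute. -/
def SchurCover.deepCommutingGraph {G : Type u} [Group G] (C : SchurCover G) : SimpleGraph G where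
  Adj x y := x ≠ y ∧ ∀ a b : C.E, C.π a = x → C.π b = y → a * b = b * a
  symm := ⟨fun _ _ h => ⟨h.1.symm, fun a b ha hb => (h.2 b a hb ha).symm⟩⟩
  loopless := ⟨fun _ h => h.1 rfl⟩

/-- The order of a stem extension of a finite group `G`, which is itself finite, is bounded in terms
of the order of `G`. -/
theorem IsStemExtension.finite_and_card_le {E G : Type u} [Group E] [Group G] [Finite G]
    {π : E →* G} (h : IsStemExtension π) :
    Finite E ∧ Nat.card E ≤ (∑ n ∈ Finset.range (Nat.card (G × G) + 1),
      Subgroup.cardCommutatorBound n) * Nat.card G := by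
  obtain ⟨s, hs⟩ := h.surjective.hasRightInverse
  have key : ∀ a : E, ∃ z ∈ Subgroup.center E, a = s (π a) * z := fun a =>
    ⟨(s (π a))⁻¹ * a, h.ker_le_center (by simp [MonoidHom.mem_ker, hs (π a)]), by group⟩
  have hsub : commutatorSet E ⊆ Set.range (fun p : G × G =>
      s p.1 * s p.2 * (s p.1)⁻¹ * (s p.2)⁻¹) := by
    rintro _ ⟨a, b, rfl⟩
    refine ⟨(π a, π b), ?_⟩
    obtain ⟨z, hz, ha⟩ := key a
    obtain ⟨w, hw, hb⟩ := key b
    have hz' := Subgroup.mem_center_iff.1 hz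
    have hw' := Subgroup.mem_center_iff.1 hw
    dsimp only
    generalize s (π a) = x at *
    generalize s (π b) = y at *
    subst ha hb
    simp only [commutatorElement_def, mul_inv_rev]
    have e1 : x * z * (y * w) = x * y * (w * z) := by
      rw [mul_assoc x z, ← hz' (y * w)]; group
    have e2 : z⁻¹ * x⁻¹ * (w⁻¹ * y⁻¹) = (w * z)⁻¹ * (x⁻¹ * y⁻¹) := by
      have : x⁻¹ * w⁻¹ = w⁻¹ * x⁻¹ := by
        rw [← mul_inv_rev, ← mul_inv_rev, hw']
      calc z⁻¹ * x⁻¹ * (w⁻¹ * y⁻¹) = z⁻¹ * (x⁻¹ * w⁻¹) * y⁻¹ := by group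
        _ = _ := by rw [this]; group
    calc x * y * x⁻¹ * y⁻¹ = x * y * (w * z) * ((w * z)⁻¹ * (x⁻¹ * y⁻¹)) := by group
      _ = x * z * (y * w) * (z⁻¹ * x⁻¹ * (w⁻¹ * y⁻¹)) := by rw [e1, e2]
      _ = _ := by group
  have hfin : Finite (commutatorSet E) := (Set.finite_range _).subset hsub
  have hcs : Nat.card (commutatorSet E) ≤ Nat.card (G × G) :=
    (Nat.card_mono (Set.finite_range _) hsub).trans (Finite.card_range_le _)
  have hcomm := (Subgroup.card_commutator_le_of_finite_commutatorSet (G := E)).trans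
    (Finset.single_le_sum (f := Subgroup.cardCommutatorBound) (fun _ _ => Nat.zero_le _)
      (Finset.mem_range.2 (Nat.lt_succ_of_le hcs)))
  have hkerfin : Finite π.ker :=
    Finite.of_injective _ (Subgroup.inclusion_injective h.ker_le_commutator)
  have hker : Nat.card π.ker ≤ Nat.card (commutator E) :=
    Nat.card_le_card_of_injective _ (Subgroup.inclusion_injective h.ker_le_commutator)
  have hidx : π.ker.index = Nat.card G := by
    rw [Subgroup.index_ker, MonoidHom.range_eq_top.2 h.surjective, Subgroup.card_top]
  have hcard : Nat.card E = Nat.card π.ker * Nat.card G := by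
    rw [← hidx, Subgroup.card_mul_index]
  refine ⟨Nat.finite_of_card_ne_zero ?_, ?_⟩
  · rw [hcard]
    exact mul_ne_zero Nat.card_pos.ne' Nat.card_pos.ne'
  · rw [hcard]
    exact Nat.mul_le_mul_right _ (hker.trans hcomm)

/-- Every finite group has a Schur cover. -/
instance SchurCover.instNonempty (G : Type u) [Group G] [Finite G] : Nonempty (SchurCover G) := by
  classical
  let P : ℕ → Prop := fun n => ∃ (E : Type u) (_ : Group E) (π : E →* G),
    IsStemExtension π ∧ Nat.card E = n
  set N := (∑ n ∈ Finset.range (Nat.card (G × G) + 1),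
      Subgroup.cardCommutatorBound n) * Nat.card G with hN
  have hid : IsStemExtension (MonoidHom.id G) :=
    ⟨Function.surjective_id, fun x hx => by
      rw [MonoidHom.mem_ker, MonoidHom.id_apply] at hx
      exact hx ▸ one_mem _, fun x hx => by
      rw [MonoidHom.mem_ker, MonoidHom.id_apply] at hx
      exact hx ▸ one_mem _⟩
  have h0 : P (Nat.card G) := ⟨G, inferInstance, MonoidHom.id G, hid, rfl⟩
  obtain ⟨E, _, π, hπ, hE⟩ := Nat.findGreatest_spec (P := P) (n := N)
    hid.finite_and_card_le.2 h0
  exact ⟨⟨E, π, hπ, hπ.finite_and_card_le.1, fun E' _ π' h' => hE ▸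
    Nat.le_findGreatest h'.finite_and_card_le.2 ⟨E', inferInstance, π', h', rfl⟩⟩⟩

/-!
Let `F / R` be the free presentation of a finite group. The kernel of the central extension
`F / [F, R]` splits as a direct product of a free abelian group `M` and its intersection with the
commutator subgroup, so the quotient by `M` is a stem extension. As a Schur cover has maximal order,
it follows that the map from `F / [F, R]` to it is injective on commutators. Hence two elements are
adjacent in the deep commuting graph iff their lifts commute in every central extension. This
relation is functorial, so it is not affected by a direct factor `H`. On `(ℤ/N)²` the Heisenberg
group and the bilinearity of commutators identify it with the vanishing of the determinant of two
vectors. If `N` is a product of distinct primes, one for each pair of vertices, the Chinese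
remainder theorem allows one to decide for each pair separately whether the determinant vanishes.
-/

open scoped commutatorElement

/-- `π : E →* G` is a central extension of `G`: it is surjective and its kernel is central. -/
structure IsCentralExtension {E G : Type*} [Group E] [Group G] (π : E →* G) : Prop where
  surjective : Function.Surjective π
  ker_le_center : π.ker ≤ Subgroup.center E

theorem IsStemExtension.isCentralExtension {E G : Type u} [Group E] [Group G] {π : E →* G}
    (hπ : IsStemExtension π) : IsCentralExtension π :=
  ⟨hπ.surjective, hπ.ker_le_center⟩

/-- `x` and `y` commute deeply if their lifts commute in every central extension of `G`. For finite
`G` this is adjacency in the deep commuting graph without reference to a Schur cover. -/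
def DeepCommute {G : Type u} [Group G] (x y : G) : Prop :=
  ∀ ⦃E : Type u⦄ [Group E] ⦃π : E →* G⦄, IsCentralExtension π →
    ∀ ⦃a b : E⦄, π a = x → π b = y → Commute a b

namespace IsCentralExtension

section

variable {E F G : Type*} [Group E] [Group F] [Group G] {π : E →* G}

theorem commutatorElement_congr (hπ : IsCentralExtension π) {a a' b b' : E}
    (ha : π a = π a') (hb : π b = π b') : ⁅a, b⁆ = ⁅a', b'⁆ := by
  have commutes : ∀ {c c' : E}, π c = π c' → ∀ g, Commute (c⁻¹ * c') g := fun h g =>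
    (Subgroup.mem_center_iff.1 (hπ.ker_le_center (π.eq_iff.1 h.symm)) g).symm
  calc ⁅a, b⁆ = ⁅a * (a⁻¹ * a'), b⁆ := by
        rw [commutatorElement_mul_left_eq_conj_mul, (commutes ha b).commutator_eq]; simp
    _ = ⁅a * (a⁻¹ * a'), b * (b⁻¹ * b')⁆ := by
        rw [commutatorElement_mul_right_eq_mul_conj _ b, (commutes hb _).symm.commutator_eq]; simp
    _ = ⁅a', b'⁆ := by simp only [mul_inv_cancel_left]

theorem commutator_le_map (hπ : IsCentralExtension π) {θ : F →* E}
    (hθ : Function.Surjective (π.comp θ)) : commutator E ≤ (commutator F).map θ := by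
  rw [commutator_def, Subgroup.commutator_le]
  intro a _ b _
  obtain ⟨u, hu⟩ := hθ (π a)
  obtain ⟨v, hv⟩ := hθ (π b)
  rw [hπ.commutatorElement_congr hu.symm hv.symm, ← map_commutatorElement]
  exact Subgroup.mem_map_of_mem θ
    (Subgroup.commutator_mem_commutator (Subgroup.mem_top u) (Subgroup.mem_top v))

theorem pullback (hπ : IsCentralExtension π) (φ : F →* G) :
    IsCentralExtension ((MonoidHom.snd E F).comp
      ((π.comp (.fst E F)).eqLocus (φ.comp (.snd E F))).subtype) where
  surjective f := by
    obtain ⟨e, he⟩ := hπ.surjective (φ f)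
    exact ⟨⟨(e, f), he⟩, rfl⟩
  ker_le_center := by
    rintro ⟨⟨e, f⟩, h : π e = φ f⟩ (rfl : f = 1)
    have he := Subgroup.mem_center_iff.1 (hπ.ker_le_center (h.trans (map_one φ)))
    exact Subgroup.mem_center_iff.2 fun ⟨⟨e', f'⟩, _⟩ =>
      Subtype.ext (Prod.ext (he e') ((mul_one f').trans (one_mul f').symm))

theorem commutator_le_center {A : Type*} [CommGroup A] {π : E →* A} (hπ : IsCentralExtension π) :
    commutator E ≤ Subgroup.center E :=
  (Abelianization.commutator_subset_ker π).trans hπ.ker_le_center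

end

theorem isStemExtension_lift {U G : Type u} [Group U] [Group G] {p : U →* G}
    (hp : IsCentralExtension p) {M : Subgroup U} [M.Normal] (hM : M ≤ p.ker)
    (hker : p.ker ≤ M ⊔ commutator U) : IsStemExtension (QuotientGroup.lift M p hM) where
  surjective := QuotientGroup.lift_surjective_of_surjective M p hp.surjective hM
  ker_le_center := by
    rw [QuotientGroup.ker_lift]
    rintro _ ⟨k, hk, rfl⟩
    refine Subgroup.mem_center_iff.2 fun g => ?_
    obtain ⟨g, rfl⟩ := QuotientGroup.mk'_surjective M g
    rw [← map_mul, ← map_mul, Subgroup.mem_center_iff.1 (hp.ker_le_center hk)]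
  ker_le_commutator := by
    calc (QuotientGroup.lift M p hM).ker = p.ker.map (QuotientGroup.mk' M) :=
          QuotientGroup.ker_lift M p hM
      _ ≤ (M ⊔ commutator U).map (QuotientGroup.mk' M) := Subgroup.map_mono hker
      _ = (commutator U).map (QuotientGroup.mk' M) := by
          rw [Subgroup.map_sup, QuotientGroup.map_mk'_self, bot_sup_eq]
      _ ≤ commutator (U ⧸ M) := by
          rw [map_commutator_eq]
          exact Subgroup.commutator_mono le_top le_top

end IsCentralExtension

theorem IsStemExtension.map_inf_commutator {E G : Type u} {U : Type*} [Group E] [Group G]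
    [Group U] {π : E →* G} (hπ : IsStemExtension π) {p : U →* G} {θ : U →* E} (hθ : π.comp θ = p)
    (hp : Function.Surjective p) : (p.ker ⊓ commutator U).map θ = π.ker := by
  subst hθ
  apply le_antisymm
  · rintro _ ⟨c, hc, rfl⟩
    exact hc.1
  · intro k hk
    obtain ⟨c, hc, rfl⟩ :=
      hπ.isCentralExtension.commutator_le_map hp (hπ.ker_le_commutator hk)
    exact Subgroup.mem_map_of_mem θ ⟨hk, hc⟩

theorem DeepCommute.map {A G : Type u} [Group A] [Group G] {x y : A} (h : DeepCommute x y)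
    (φ : A →* G) : DeepCommute (φ x) (φ y) := by
  intro E _ π hπ a b ha hb
  have hlifts := h (hπ.pullback φ) (a := ⟨(a, x), ha⟩) (b := ⟨(b, y), hb⟩) rfl rfl
  exact congrArg (fun p => p.1.1) hlifts.eq

theorem deepCommute_inl_iff {A H : Type u} [Group A] [Group H] {x y : A} :
    DeepCommute (MonoidHom.inl A H x) (MonoidHom.inl A H y) ↔ DeepCommute x y :=
  ⟨fun h => h.map (MonoidHom.fst A H), fun h => h.map (MonoidHom.inl A H)⟩

theorem exists_isCompl_ker_of_free {K A : Type*} [CommGroup K] [CommGroup A]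
    [Module.Free ℤ (Additive A)] [Module.Finite ℤ (Additive A)] (f : K →* A) :
    ∃ M : Subgroup K, IsCompl M f.ker := by
  let F := (MonoidHom.toAdditive f).toIntLinearMap
  obtain ⟨s, hs⟩ :=
    Module.projective_lifting_property F.rangeRestrict LinearMap.id F.surjective_rangeRestrict
  let retraction := s ∘ₗ F.rangeRestrict
  have rightInverse : ∀ a, F.rangeRestrict (s a) = a := LinearMap.congr_fun hs
  have idempotent : IsIdempotentElem retraction :=
    LinearMap.ext fun k => congrArg s (rightInverse (F.rangeRestrict k))
  have s_injective : Function.Injective s := Function.LeftInverse.injective rightInverse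
  have ker_retraction : LinearMap.ker retraction = LinearMap.ker F := by
    rw [LinearMap.ker_comp_of_ker_eq_bot _ (LinearMap.ker_eq_bot.2 s_injective),
      LinearMap.ker_rangeRestrict]
  let toSubmodule : Subgroup K ≃o Submodule ℤ (Additive K) :=
    Subgroup.toAddSubgroup.trans AddSubgroup.toIntSubmodule
  refine ⟨toSubmodule.symm (LinearMap.range retraction), toSubmodule.isCompl_iff.2 ?_⟩
  rw [OrderIso.apply_symm_apply, show toSubmodule f.ker = LinearMap.ker retraction from
    ker_retraction.symm]
  exact LinearMap.IsIdempotentElem.isCompl idempotent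

/-- The free central extension `F / [F, R]` of `G`, where `F / R` is the standard free presentation
of `G`. -/
abbrev FreeCentralExtension (G : Type*) [Group G] : Type _ :=
  FreeGroup G ⧸ ⁅(FreeGroup.lift (id : G → G)).ker, (⊤ : Subgroup (FreeGroup G))⁆

namespace FreeCentralExtension

variable (G : Type*) [Group G]

/-- The projection of the free central extension of `G` onto `G`. -/
def proj : FreeCentralExtension G →* G :=
  QuotientGroup.lift _ (FreeGroup.lift id) (Subgroup.commutator_le_left _ _)

theorem isCentralExtension_proj : IsCentralExtension (proj G) where
  surjective g := ⟨QuotientGroup.mk (FreeGroup.of g), FreeGroup.lift_apply_of⟩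
  ker_le_center := by
    rw [proj, QuotientGroup.ker_lift]
    rintro _ ⟨r, hr, rfl⟩
    refine Subgroup.mem_center_iff.2 fun g => ?_
    obtain ⟨f, rfl⟩ := QuotientGroup.mk'_surjective _ g
    rw [eq_comm, ← commutatorElement_eq_one_iff_mul_comm, ← map_commutatorElement]
    exact (QuotientGroup.eq_one_iff _).2
      (Subgroup.commutator_mem_commutator hr (Subgroup.mem_top f))

variable {G}

theorem exists_comp_eq_proj {E : Type*} [Group E] {π : E →* G} (hπ : IsCentralExtension π) :
    ∃ θ : FreeCentralExtension G →* E, π.comp θ = proj G := by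
  obtain ⟨s, hs⟩ := hπ.surjective.hasRightInverse
  have hlift : π.comp (FreeGroup.lift s) = FreeGroup.lift id :=
    FreeGroup.ext_hom _ _ fun g => by simp [hs g]
  refine ⟨QuotientGroup.lift _ (FreeGroup.lift s) ?_, QuotientGroup.monoidHom_ext _ hlift⟩
  rw [Subgroup.commutator_le]
  intro r hr f _
  have hcentral : FreeGroup.lift s r ∈ Subgroup.center E :=
    hπ.ker_le_center ((DFunLike.congr_fun hlift r).trans hr)
  rw [MonoidHom.mem_ker, map_commutatorElement, commutatorElement_eq_one_iff_mul_comm,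
    Subgroup.mem_center_iff.1 hcentral]

variable (G) in
/-- The abelianization of the free central extension, as a map to the abelianization of the free
group. -/
def toFreeAbelian : FreeCentralExtension G →* Abelianization (FreeGroup G) :=
  QuotientGroup.lift _ Abelianization.of (by
    rw [Abelianization.ker_of]; exact Subgroup.commutator_mono le_top le_rfl)

theorem ker_toFreeAbelian : (toFreeAbelian G).ker = commutator (FreeCentralExtension G) := by
  rw [toFreeAbelian, QuotientGroup.ker_lift, Abelianization.ker_of, map_commutator_eq,
    MonoidHom.range_eq_top.2 (QuotientGroup.mk'_surjective _), commutator_def]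

open scoped IsMulCommutative in
theorem exists_complement_commutator [Finite G] :
    ∃ M ≤ (proj G).ker, Disjoint M (commutator (FreeCentralExtension G)) ∧
      (proj G).ker ≤ M ⊔ commutator (FreeCentralExtension G) := by
  have ker_le_center := (isCentralExtension_proj G).ker_le_center
  have : IsMulCommutative (proj G).ker :=
    ⟨⟨fun a b => Subtype.ext (Subgroup.mem_center_iff.1 (ker_le_center b.2) a)⟩⟩
  have : Module.Free ℤ (Additive (Abelianization (FreeGroup G))) :=
    inferInstanceAs (Module.Free ℤ (FreeAbelianGroup G))
  have : Module.Finite ℤ (Additive (Abelianization (FreeGroup G))) :=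
    Module.Finite.of_basis (FreeAbelianGroup.basis G)
  obtain ⟨M, hM⟩ := exists_isCompl_ker_of_free ((toFreeAbelian G).comp (proj G).ker.subtype)
  have ker_eq : ((toFreeAbelian G).comp (proj G).ker.subtype).ker.map (proj G).ker.subtype =
      (proj G).ker ⊓ commutator (FreeCentralExtension G) := by
    rw [← MonoidHom.comap_ker, ker_toFreeAbelian, Subgroup.map_comap_eq, Subgroup.range_subtype]
  refine ⟨M.map (proj G).ker.subtype, Subgroup.map_subtype_le M, ?_, ?_⟩
  · have hdisjoint := Subgroup.disjoint_map (proj G).ker.subtype_injective hM.disjoint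
    rw [ker_eq] at hdisjoint
    exact Subgroup.disjoint_def.2 fun hm hc =>
      Subgroup.disjoint_def.1 hdisjoint hm ⟨Subgroup.map_subtype_le M hm, hc⟩
  · have hsup := congrArg (Subgroup.map (proj G).ker.subtype) hM.sup_eq_top
    rw [Subgroup.map_sup, ker_eq, ← MonoidHom.range_eq_map, Subgroup.range_subtype] at hsup
    exact hsup.ge.trans (sup_le_sup_left inf_le_right _)

end FreeCentralExtension

namespace IsSchurCover

variable {E G : Type u} [Group E] [Group G] {π : E →* G}

theorem card_ker_le (hπ : IsSchurCover π) {E' : Type u} [Group E'] {π' : E' →* G}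
    (hπ' : IsStemExtension π') : Nat.card π'.ker ≤ Nat.card π.ker := by
  have := hπ.finite
  have := Finite.of_surjective π hπ.isStem.surjective
  have index_ker : ∀ {F : Type u} [Group F] {ρ : F →* G}, Function.Surjective ρ →
      ρ.ker.index = Nat.card G := fun hρ => by
    rw [Subgroup.index_ker, MonoidHom.range_eq_top.2 hρ, Subgroup.card_top]
  refine Nat.le_of_mul_le_mul_right ?_ (Nat.card_pos : 0 < Nat.card G)
  calc Nat.card π'.ker * Nat.card G = Nat.card E' := by
        rw [← index_ker hπ'.surjective, Subgroup.card_mul_index]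
    _ ≤ Nat.card E := hπ.card_le E' π' hπ'
    _ = Nat.card π.ker * Nat.card G := by
        rw [← index_ker hπ.isStem.surjective, Subgroup.card_mul_index]

theorem disjoint_ker_commutator (hπ : IsSchurCover π) {U : Type u} [Group U] {p : U →* G}
    (hp : IsCentralExtension p) {M : Subgroup U} (hM : M ≤ p.ker)
    (hdisjoint : Disjoint M (commutator U)) (hker : p.ker ≤ M ⊔ commutator U)
    {θ : U →* E} (hθ : π.comp θ = p) : Disjoint θ.ker (commutator U) := by
  have := hπ.finite
  have := Finite.of_surjective π hπ.isStem.surjective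
  have : M.Normal := ⟨fun m hm g => by
    rwa [Subgroup.mem_center_iff.1 (hp.ker_le_center (hM hm)) g, mul_inv_cancel_right]⟩
  have stem := hp.isStemExtension_lift hM hker
  have := stem.finite_and_card_le.1
  let L := p.ker ⊓ commutator U
  let toStem : L →* (QuotientGroup.lift M p hM).ker :=
    ((QuotientGroup.mk' M).comp L.subtype).codRestrict _ fun c => c.2.1
  have toStem_injective : Function.Injective toStem := by
    refine (injective_iff_map_eq_one _).2 fun c hc => Subtype.ext ?_
    exact Subgroup.disjoint_def.1 hdisjoint
      ((QuotientGroup.eq_one_iff _).1 (congrArg Subtype.val hc)) c.2.2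
  have := Finite.of_injective toStem toStem_injective
  have map_eq : L.map θ = π.ker := hπ.isStem.map_inf_commutator hθ hp.surjective
  have bijective : Function.Bijective (θ.subgroupMap L) := by
    refine (θ.subgroupMap_surjective L).bijective_of_nat_card_le ?_
    rw [map_eq]
    exact (Nat.card_le_card_of_injective toStem toStem_injective).trans (hπ.card_ker_le stem)
  refine Subgroup.disjoint_def.2 fun {c} (hc : θ c = 1) hc' => ?_
  have hcL : c ∈ L := ⟨show p c = 1 by rw [← hθ, MonoidHom.comp_apply, hc, map_one], hc'⟩
  exact congrArg Subtype.val
    (bijective.injective (a₁ := ⟨c, hcL⟩) (a₂ := 1) (Subtype.ext (by simpa using hc)))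

theorem commute_iff_deepCommute (hπ : IsSchurCover π) {a b : E} :
    Commute a b ↔ DeepCommute (π a) (π b) := by
  refine ⟨fun hab E' _ π' hπ' a' b' ha' hb' => ?_,
    fun h => h hπ.isStem.isCentralExtension rfl rfl⟩
  have := hπ.finite
  have := Finite.of_surjective π hπ.isStem.surjective
  have hp := FreeCentralExtension.isCentralExtension_proj G
  obtain ⟨M, hM, hdisjoint, hker⟩ := FreeCentralExtension.exists_complement_commutator (G := G)
  obtain ⟨θ, hθ⟩ := FreeCentralExtension.exists_comp_eq_proj hπ.isStem.isCentralExtension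
  obtain ⟨θ', hθ'⟩ := FreeCentralExtension.exists_comp_eq_proj hπ'
  obtain ⟨u, hu⟩ := hp.surjective (π a)
  obtain ⟨v, hv⟩ := hp.surjective (π b)
  have map_θ : θ ⁅u, v⁆ = 1 := by
    rw [map_commutatorElement, ← hab.commutator_eq]
    exact hπ.isStem.isCentralExtension.commutatorElement_congr
      ((DFunLike.congr_fun hθ u).trans hu) ((DFunLike.congr_fun hθ v).trans hv)
  have huv : ⁅u, v⁆ = 1 :=
    Subgroup.disjoint_def.1 (hπ.disjoint_ker_commutator hp hM hdisjoint hker hθ) map_θ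
      (Subgroup.commutator_mem_commutator (Subgroup.mem_top u) (Subgroup.mem_top v))
  rw [← commutatorElement_eq_one_iff_commute]
  calc ⁅a', b'⁆ = ⁅θ' u, θ' v⁆ := hπ'.commutatorElement_congr
        (ha'.trans (hu.symm.trans (DFunLike.congr_fun hθ' u).symm))
        (hb'.trans (hv.symm.trans (DFunLike.congr_fun hθ' v).symm))
    _ = 1 := by rw [← map_commutatorElement, huv, map_one]

end IsSchurCover

theorem SchurCover.deepCommutingGraph_adj {G : Type u} [Group G] (C : SchurCover G) {x y : G} :
    C.deepCommutingGraph.Adj x y ↔ x ≠ y ∧ DeepCommute x y := by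
  refine and_congr_right fun _ => ⟨fun h => ?_, fun h a b ha hb => ?_⟩
  · obtain ⟨a, rfl⟩ := C.isSchurCover.isStem.surjective x
    obtain ⟨b, rfl⟩ := C.isSchurCover.isStem.surjective y
    exact C.isSchurCover.commute_iff_deepCommute.1 (h a b rfl rfl)
  · exact h C.isSchurCover.isStem.isCentralExtension ha hb

section ClassTwo

variable {E : Type*} [Group E] (h : commutator E ≤ Subgroup.center E)

include h

theorem commutatorElement_mem_center (a b : E) : ⁅a, b⁆ ∈ Subgroup.center E :=
  h (Subgroup.commutator_mem_commutator (Subgroup.mem_top a) (Subgroup.mem_top b))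

theorem commutatorElement_mul_left (a a' b : E) : ⁅a * a', b⁆ = ⁅a, b⁆ * ⁅a', b⁆ := by
  have central := Subgroup.mem_center_iff.1 (commutatorElement_mem_center h a' b)
  rw [commutatorElement_mul_left_eq_conj_mul, central, mul_inv_cancel_right, central]

theorem commutatorElement_mul_right (a b b' : E) : ⁅a, b * b'⁆ = ⁅a, b⁆ * ⁅a, b'⁆ := by
  have central := Subgroup.mem_center_iff.1 (commutatorElement_mem_center h a b')
  rw [commutatorElement_mul_right_eq_mul_conj, mul_assoc _ b, central, ← mul_assoc,
    mul_inv_cancel_right]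

open scoped IsMulCommutative in
/-- The commutator pairing of a group of nilpotency class at most two, with values in the centre. -/
def commutatorPairing : E →* E →* Subgroup.center E :=
  MonoidHom.mk'
    (fun a => MonoidHom.mk' (fun b => ⟨⁅a, b⁆, commutatorElement_mem_center h a b⟩)
      fun b b' => Subtype.ext (commutatorElement_mul_right h a b b'))
    fun a a' => MonoidHom.ext fun b => Subtype.ext (commutatorElement_mul_left h a a' b)

open scoped IsMulCommutative in
theorem commutatorElement_zpow_left (x y : E) (n : ℤ) : ⁅x ^ n, y⁆ = ⁅x, y⁆ ^ n :=
  congrArg Subtype.val (DFunLike.congr_fun (map_zpow (commutatorPairing h) x n) y)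

open scoped IsMulCommutative in
theorem commutatorElement_zpow_mul_zpow (x y : E) (s t s' t' : ℤ) :
    ⁅x ^ s * y ^ t, x ^ s' * y ^ t'⁆ = ⁅x, y⁆ ^ (s * t' - s' * t) := by
  let B := commutatorPairing h
  have alternating : ∀ z, B z z = 1 := fun z => Subtype.ext (commutatorElement_self z)
  have antisymmetric : B y x = (B x y)⁻¹ := Subtype.ext (commutatorElement_inv x y).symm
  suffices B (x ^ s * y ^ t) (x ^ s' * y ^ t') = B x y ^ (s * t' - s' * t) from
    congrArg Subtype.val this
  simp only [map_mul, map_zpow, MonoidHom.mul_apply, MonoidHom.zpow_apply, alternating,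
    antisymmetric]
  rw [one_zpow, one_zpow]
  group

end ClassTwo

theorem IsCentralExtension.commute_of_mul_eq_mul {E : Type*} [Group E] {N : ℕ}
    {π : E →* Multiplicative (ZMod N × ZMod N)} (hπ : IsCentralExtension π) {a b : E}
    (hab : (π a).toAdd.1 * (π b).toAdd.2 = (π b).toAdd.1 * (π a).toAdd.2) : Commute a b := by
  have h := hπ.commutator_le_center
  obtain ⟨x, hx⟩ := hπ.surjective (.ofAdd (1, 0))
  obtain ⟨y, hy⟩ := hπ.surjective (.ofAdd (0, 1))
  have map_zpow_mul_zpow (s t : ℤ) : π (x ^ s * y ^ t) = .ofAdd ((s : ZMod N), (t : ZMod N)) := by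
    simp [hx, hy, ← ofAdd_zsmul, ← ofAdd_add]
  have exists_exponents (c : E) : ∃ s t : ℤ, π c = π (x ^ s * y ^ t) := by
    obtain ⟨s, hs⟩ := ZMod.intCast_surjective (π c).toAdd.1
    obtain ⟨t, ht⟩ := ZMod.intCast_surjective (π c).toAdd.2
    exact ⟨s, t, by rw [map_zpow_mul_zpow, hs, ht]; rfl⟩
  obtain ⟨s, t, ha⟩ := exists_exponents a
  obtain ⟨s', t', hb⟩ := exists_exponents b
  have det_eq_zero : ((s * t' - s' * t : ℤ) : ZMod N) = 0 := by
    simpa [ha, hb, map_zpow_mul_zpow, sub_eq_zero] using hab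
  have central : x ^ (s * t' - s' * t) ∈ Subgroup.center E := hπ.ker_le_center <| by
    rw [MonoidHom.mem_ker, ← mul_one (x ^ _), ← zpow_zero y, map_zpow_mul_zpow, det_eq_zero,
      Int.cast_zero]
    rfl
  rw [← commutatorElement_eq_one_iff_commute]
  calc ⁅a, b⁆ = ⁅x ^ s * y ^ t, x ^ s' * y ^ t'⁆ := hπ.commutatorElement_congr ha hb
    _ = ⁅x ^ (s * t' - s' * t), y⁆ := by
        rw [commutatorElement_zpow_mul_zpow h, commutatorElement_zpow_left h]
    _ = 1 := commutatorElement_eq_one_iff_mul_comm.2 (Subgroup.mem_center_iff.1 central y).symm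

/-- The Heisenberg group of upper unitriangular `3 × 3` matrices over `R`, where `a`, `b`, `c` are
the entries at `(1, 2)`, `(2, 3)`, `(1, 3)`. -/
@[ext]
structure Heisenberg (R : Type*) where
  a : R
  b : R
  c : R

namespace Heisenberg

variable {R : Type*}

instance [Finite R] : Finite (Heisenberg R) :=
  Finite.of_injective (fun x => (x.a, x.b, x.c)) fun x y h => by
    simpa [Heisenberg.ext_iff] using h

variable [CommRing R]

instance : Mul (Heisenberg R) := ⟨fun x y => ⟨x.a + y.a, x.b + y.b, x.c + y.c + x.a * y.b⟩⟩

instance : One (Heisenberg R) := ⟨⟨0, 0, 0⟩⟩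

instance : Inv (Heisenberg R) := ⟨fun x => ⟨-x.a, -x.b, -x.c + x.a * x.b⟩⟩

theorem mul_def (x y : Heisenberg R) :
    x * y = ⟨x.a + y.a, x.b + y.b, x.c + y.c + x.a * y.b⟩ := rfl

theorem one_def : (1 : Heisenberg R) = ⟨0, 0, 0⟩ := rfl

theorem inv_def (x : Heisenberg R) : x⁻¹ = ⟨-x.a, -x.b, -x.c + x.a * x.b⟩ := rfl

instance : Group (Heisenberg R) :=
  Group.ofLeftAxioms
    (fun x y z => by simp only [mul_def, mk.injEq]; refine ⟨?_, ?_, ?_⟩ <;> ring)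
    (fun x => by simp [mul_def, one_def])
    (fun x => by simp [mul_def, one_def, inv_def])

theorem commute_iff {x y : Heisenberg R} : Commute x y ↔ x.a * y.b = y.a * x.b := by
  rw [commute_iff_eq, mul_def, mul_def, mk.injEq, add_comm y.a, add_comm y.b, add_comm y.c]
  simp only [true_and, add_right_inj]

variable (R) in
/-- The quotient map of the Heisenberg group onto its abelianization. -/
def proj : Heisenberg R →* Multiplicative (R × R) where
  toFun x := .ofAdd (x.a, x.b)
  map_one' := rfl
  map_mul' _ _ := rfl

theorem isCentralExtension_proj : IsCentralExtension (proj R) where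
  surjective u := ⟨⟨u.toAdd.1, u.toAdd.2, 0⟩, rfl⟩
  ker_le_center x (hx : Multiplicative.ofAdd (x.a, x.b) = 1) := by
    obtain ⟨ha, hb⟩ : x.a = 0 ∧ x.b = 0 := by simpa using hx
    exact Subgroup.mem_center_iff.2 fun y => (commute_iff.2 (by rw [ha, hb, mul_zero, zero_mul])).eq

instance : Group.IsNilpotent (Heisenberg R) :=
  Subgroup.isNilpotent_of_ker_le_center (proj R) isCentralExtension_proj.ker_le_center

theorem not_isMulCommutative [Nontrivial R] : ¬ ∀ x y : Heisenberg R, x * y = y * x := fun h => by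
  simpa using commute_iff.1 (h ⟨1, 0, 0⟩ ⟨0, 1, 0⟩)

end Heisenberg

theorem DeepCommute.mul_eq_mul {R : Type u} [CommRing R] {u v : R × R}
    (h : DeepCommute (Multiplicative.ofAdd u) (Multiplicative.ofAdd v)) :
    u.1 * v.2 = v.1 * u.2 :=
  Heisenberg.commute_iff.1
    (h Heisenberg.isCentralExtension_proj (a := ⟨u.1, u.2, 0⟩) (b := ⟨v.1, v.2, 0⟩) rfl rfl)

theorem deepCommute_ofAdd_iff {N : ℕ} {u v : ZMod N × ZMod N} :
    DeepCommute (Multiplicative.ofAdd u) (Multiplicative.ofAdd v) ↔ u.1 * v.2 = v.1 * u.2 := by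
  refine ⟨DeepCommute.mul_eq_mul, fun h E _ π hπ a b ha hb => hπ.commute_of_mul_eq_mul ?_⟩
  rwa [ha, hb]

/-- `f` represents the graph `Γ` by pairs over `R`: it is injective, and two distinct vertices are
adjacent iff the `2 × 2` determinant of their pairs vanishes. -/
structure IsDeterminantRepresentation {V R : Type*} [CommRing R] (Γ : SimpleGraph V)
    (f : V → R × R) : Prop where
  injective : Function.Injective f
  adj_iff : ∀ ⦃v w⦄, v ≠ w → (Γ.Adj v w ↔ (f v).1 * (f w).2 = (f w).1 * (f v).2)

theorem IsDeterminantRepresentation.map {V R S : Type*} [CommRing R] [CommRing S]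
    {Γ : SimpleGraph V} {f : V → R × R} (hf : IsDeterminantRepresentation Γ f) {φ : R →+* S}
    (hφ : Function.Injective φ) : IsDeterminantRepresentation Γ (Prod.map φ φ ∘ f) where
  injective := (hφ.prodMap hφ).comp hf.injective
  adj_iff v w hvw := by simp [hf.adj_iff hvw, ← map_mul, hφ.eq_iff]

theorem exists_isDeterminantRepresentation_pi {V : Type*} (Γ : SimpleGraph V) (R : V × V → Type*)
    [∀ e, CommRing (R e)] [∀ e, Nontrivial (R e)] :
    ∃ f : V → (∀ e, R e) × (∀ e, R e), IsDeterminantRepresentation Γ f := by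
  classical
  let F : V → ∀ e, R e := fun v e => if v = e.1 ∧ ¬ Γ.Adj e.1 e.2 then 1 else 0
  let S : V → ∀ e, R e := fun v e => if v = e.2 then 1 else 0
  refine ⟨fun v => (F v, S v), ⟨fun v w h => ?_, fun v w hvw => ⟨fun hadj => ?_, fun h => ?_⟩⟩⟩
  · by_contra hne
    simpa [S, Ne.symm hne] using congrFun (congrArg Prod.snd h) (v, v)
  · have hadj' := hadj.symm
    funext ⟨a, b⟩
    simp only [Pi.mul_apply, F, S]
    split_ifs <;> grind
  · by_contra hadj
    simpa [F, S, hadj, hvw, hvw.symm] using congrFun h (v, w)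

theorem exists_isDeterminantRepresentation_zmod {V : Type*} [Finite V] (Γ : SimpleGraph V) :
    ∃ N ≠ 0, ∃ f : V → ZMod N × ZMod N, IsDeterminantRepresentation Γ f := by
  have := Fintype.ofFinite V
  let p : V × V ↪ Nat.Primes :=
    (Fintype.equivFin (V × V)).toEmbedding.trans
      (Fin.valEmbedding.trans (Infinite.natEmbedding Nat.Primes))
  have coprime : Pairwise fun e e' => (p e : ℕ).Coprime (p e') := fun e e' h =>
    (Nat.coprime_primes (p e).2 (p e').2).2 fun h' => h (p.injective (Subtype.ext h'))
  have (e : V × V) : Nontrivial (ZMod (p e)) := ZMod.nontrivial_iff.2 (p e).2.ne_one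
  obtain ⟨f, hf⟩ := exists_isDeterminantRepresentation_pi Γ fun e => ZMod (p e)
  exact ⟨∏ e, (p e : ℕ), Finset.prod_ne_zero_iff.2 fun e _ => (p e).2.ne_zero, _,
    hf.map (φ := (ZMod.prodEquivPi (fun e => (p e : ℕ)) coprime).symm.toRingHom)
      (RingEquiv.injective _)⟩

theorem IsDeterminantRepresentation.isIndContained_deepCommutingGraph {V : Type*}
    {Γ : SimpleGraph V} {N : ℕ} {f : V → ZMod N × ZMod N} (hf : IsDeterminantRepresentation Γ f)
    {H : Type} [Group H] (C : SchurCover (Multiplicative (ZMod N × ZMod N) × H)) :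
    Γ.IsIndContained C.deepCommutingGraph := by
  have injective : Function.Injective fun v => MonoidHom.inl _ H (Multiplicative.ofAdd (f v)) :=
    fun v w h => hf.injective (Multiplicative.ofAdd.injective (congrArg Prod.fst h))
  refine ⟨⟨⟨_, injective⟩, fun {v w} => ?_⟩⟩
  rw [Function.Embedding.coeFn_mk, C.deepCommutingGraph_adj, injective.ne_iff, deepCommute_inl_iff,
    deepCommute_ofAdd_iff]
  exact ⟨fun h => (hf.adj_iff h.1).2 h.2, fun h => ⟨h.ne, (hf.adj_iff h.ne).1 h⟩⟩

theorem mainTheorem5 {V : Type*} [Finite V] (Γ : SimpleGraph V) :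
    (∃ (G : Type) (_ : Group G) (_ : Finite G), Group.IsNilpotent G ∧
      ∀ C : SchurCover G, Γ.IsIndContained C.deepCommutingGraph) ∧
    (∃ (G : Type) (_ : Group G) (_ : Finite G), (∀ a b : G, a * b = b * a) ∧
      ∀ C : SchurCover G, Γ.IsIndContained C.deepCommutingGraph) ∧
    (∃ (G : Type) (_ : Group G) (_ : Finite G), Group.IsNilpotent G ∧
      (¬ ∀ a b : G, a * b = b * a) ∧
      ∀ C : SchurCover G, Γ.IsIndContained C.deepCommutingGraph) := by
  obtain ⟨N, hN, f, hf⟩ := exists_isDeterminantRepresentation_zmod Γ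
  have : NeZero N := ⟨hN⟩
  let A := Multiplicative (ZMod N × ZMod N)
  refine ⟨⟨A × Unit, inferInstance, inferInstance, inferInstance,
      hf.isIndContained_deepCommutingGraph⟩,
    ⟨A × Unit, inferInstance, inferInstance, mul_comm, hf.isIndContained_deepCommutingGraph⟩,
    ⟨A × Heisenberg (ZMod 2), inferInstance, inferInstance, inferInstance, fun h => ?_,
      hf.isIndContained_deepCommutingGraph⟩⟩
  exact Heisenberg.not_isMulCommutative fun x y => congrArg Prod.snd (h (1, x) (1, y))
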